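/- An uncertain point of $\mathbb R^1$ with $k$ locations is a tuple $p_i=(p_{i,1},\dots,p_{i,k})$ of real numbers together with probabilities $w_{i,1},\dots,w_{i,k}\ge 0$, $\sum_j w_{i,j}=1$; it is located at $p_{i,j}$ with probability $w_{i,j}$, independently of the other points (the uniform case is $w_{i,j}=1/k$). For a non-empty finite family $T$ of uncertain points and a set $r\subseteq\mathbb R$, let $E_{r(T)}=\mathbf E\big[\,|Q\cap r|/|Q|\,\big]$, where $Q$ is a random transversal of $T$, i.e. a random instantiation of all points of $T$, counted with multiplicity (so $|Q|=|T|$). A non-empty subfamily $T\subseteq P$ is an $\varepsilon$-RE coreset of $(P,\mathcal A)$ if $|E_{r(P)}-E_{r(T)}|\le\varepsilon$ for all $r\in\mathcal A$. Let $\mathcal I_+$ be the family of all intervals $(-\infty,x]$ and $\mathcal I$ the family of all intervals $[y,x]$ with $y\le x$. **Theorem.** There is an absolute constant $C>0$ such that the following holds for $\mathcal A=\mathcal I_+$ and also for $\mathcal A=\mathcal I$. 1. For all $n,k\ge 1$, every family $P$ of $n$ uncertain points of $\mathbb R^1$ with $k$ locations each, and every real $0<\varepsilon\le 1$, there is an $\varepsilon$-RE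 coreset $T\subseteq P$ of $(P,\mathcal A)$ with $$|T|\le C\,\frac{\sqrt k}{\varepsilon}\log\frac{2k}{\varepsilon}.$$ 2. Such a coreset can be constructed: there is one computable function which, for all $n,k\ge1$, all $P$ as above with rational probabilities and all rational $0<\varepsilon\le1$, computes the set of indices of such a $T$, with the same size bound, from $\varepsilon$, the probabilities (written over a common denominator), and the order of the $nk$ real locations (each location being given by its rank, the number of locations strictly to its left). -/

import Mathlib

namespace UncertainData

/-- An uncertain point of the real line: `k` possible locations, the `j`-th one being taken
with probability `prob j`. -/
structure UncertainPoint (k : ℕ) where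
  loc : Fin k → ℝ
  prob : Fin k → ℝ
  prob_nonneg : ∀ j, 0 ≤ prob j
  prob_sum : ∑ j, prob j = 1

open Classical in
/-- The expectation of `|Q ∩ r| / |Q|` over a random transversal `Q` of the subfamily of `P`
indexed by `T`. A transversal picks one location for each `i ∈ T`; the picks are independent, so
the transversal `Q` has probability `∏ i, (P i).prob (Q i)`. -/
noncomputable def rangeExpectation {n k : ℕ} (P : Fin n → UncertainPoint k) (T : Finset (Fin n))
    (r : Set ℝ) : ℝ :=
  ∑ Q : T → Fin k, (∏ i : T, (P i).prob (Q i)) *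
    (((Finset.univ.filter fun i : T => (P i).loc (Q i) ∈ r).card : ℝ) / (T.card : ℝ))

/-- `T` indexes an `ε`-RE coreset of `P` for the family of ranges `A`. -/
def IsRECoreset {n k : ℕ} (P : Fin n → UncertainPoint k) (T : Finset (Fin n))
    (A : Set (Set ℝ)) (ε : ℝ) : Prop :=
  T.Nonempty ∧ ∀ r ∈ A, |rangeExpectation P Finset.univ r - rangeExpectation P T r| ≤ ε

/-- The one-sided intervals `(-∞, x]`. -/
def oneSided : Set (Set ℝ) := {r | ∃ x : ℝ, r = Set.Iic x}

/-- The two-sided intervals `[y, x]`. -/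
def twoSided : Set (Set ℝ) := {r | ∃ y x : ℝ, y ≤ x ∧ r = Set.Icc y x}

/-- The position of the `j`-th location of the `i`-th point in the order of all locations: the
number of locations that lie strictly to its left (equal locations get equal ranks). -/
noncomputable def rank {n k : ℕ} (P : Fin n → UncertainPoint k) (i : Fin n) (j : Fin k) : ℕ :=
  (Finset.univ.filter fun q : Fin n × Fin k => (P q.1).loc q.2 < (P i).loc j).card

/-- What an algorithm is given: the error `a / b` as the pair `(a, b)`, the common denominator of
the probabilities, and for each uncertain point the list of the pairs
(rank of the location, numerator of its probability). -/
abbrev Input : Type := (ℕ × ℕ) × ℕ × List (List (ℕ × ℕ))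

/-- The input that describes the points `P`, whose probabilities are `c i j / D`, and the error
`a / b`. Of the locations it contains only their order. -/
noncomputable def input {n k : ℕ} (P : Fin n → UncertainPoint k) (c : Fin n → Fin k → ℕ)
    (D a b : ℕ) : Input :=
  ((a, b), D, List.ofFn fun i => List.ofFn fun j => (rank P i j, c i j))

end UncertainData

namespace UncertainData

open Finset

/-! By linearity of expectation, `rangeExpectation P T r` is the average over `T` of the masses of
`r`. For one-sided ranges the mass of the `i`-th point is a monotone function of the endpoint with
values in [0,1], whatever the number of locations. The task is thus to sample a family of
distribution functions by a small subfamily.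

Start from the constant weights s/n and round them to 0 or 1, changing every weighted sum by only
O(log s). As long as there are more fractional weights than linear constraints, a kernel direction
makes a weight integral and keeps all constraints. Monotonicity makes few constraints enough: fix
the sums at representative endpoints, and the error elsewhere is bounded by the variation within a
class. The first pass leaves O(s) fractional weights at cost 1
(`exists_integral_rounding_of_sum_le`); each further pass halves their number at cost 4
(`exists_integral_rounding`).

At the largest location all masses are 1, so the same bound controls |T|. With s of order (1/ε)
log(2/ε) the averages differ by at most ε. This size is free of k; the stated bound with √k is
weaker. A two-sided range is a difference of two one-sided ones, at error ε/2 each.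

For the construction, the coreset property is a finite set of integer inequalities in ranks and
numerators, so exhaustive search for a shortest passing index list is primitive recursive and
inherits the existence bound. -/

/-! ### Rounding along kernel directions -/

/-- The coordinates at which `y` lies strictly between `0` and `1`. -/
noncomputable def fractional {ι : Type*} [Fintype ι] (y : ι → ℝ) : Finset ι :=
  open Classical in univ.filter fun i => 0 < y i ∧ y i < 1

theorem mem_fractional {ι : Type*} [Fintype ι] {y : ι → ℝ} {i : ι} :
    i ∈ fractional y ↔ 0 < y i ∧ y i < 1 := by
  simp [fractional]

theorem exists_ne_zero_supported_of_card_lt {ι κ : Type*} [Fintype ι] [Fintype κ]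
    (S : Finset ι) (A : κ → ι → ℝ) (h : Fintype.card κ < S.card) :
    ∃ z : ι → ℝ, z ≠ 0 ∧ (∀ i ∉ S, z i = 0) ∧ ∀ k, ∑ i, z i * A k i = 0 := by
  classical
  let f : (S → ℝ) →ₗ[ℝ] (κ → ℝ) := Matrix.toLin' (Matrix.of fun k (i : S) => A k i)
  have hf : LinearMap.ker f ≠ ⊥ := LinearMap.ker_ne_bot_of_finrank_lt (by simpa using h)
  obtain ⟨v, hv, hv0⟩ := Submodule.exists_mem_ne_zero_of_ne_bot hf
  refine ⟨fun i => if hi : i ∈ S then v ⟨i, hi⟩ else 0, ?_, fun i hi => by simp [hi], ?_⟩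
  · intro h0
    apply hv0
    ext ⟨i, hi⟩
    simpa [hi] using congrFun h0 i
  · intro k
    have hk := congrFun (LinearMap.mem_ker.mp hv) k
    simp only [f, Matrix.toLin'_apply, Matrix.mulVec, dotProduct, Matrix.of_apply,
      Pi.zero_apply] at hk
    rw [← sum_subset (subset_univ S) (fun i _ hi => by simp [hi]), ← sum_coe_sort, ← hk]
    exact sum_congr rfl fun i _ => by simp [mul_comm]

/-- Walk along `z` until the first moving coordinate hits 0 or 1. Coordinates that are already
integral do not move, so the fractional set shrinks strictly. -/
theorem exists_step_to_boundary {ι : Type*} [Fintype ι] {y z : ι → ℝ}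
    (hy : ∀ i, y i ∈ Set.Icc (0 : ℝ) 1) (hz : z ≠ 0) (hS : ∀ i ∉ fractional y, z i = 0) :
    ∃ t : ℝ, (∀ i, y i + t * z i ∈ Set.Icc (0 : ℝ) 1) ∧
      fractional (fun i => y i + t * z i) ⊂ fractional y := by
  classical
  obtain ⟨j, hj⟩ := Function.ne_iff.mp hz
  -- The step length at which coordinate `i` reaches the face it moves towards; only used where `z i
  -- ≠ 0`.
  let τ : ι → ℝ := fun i => if 0 < z i then (1 - y i) / z i else y i / (-z i)
  obtain ⟨m, hm, hmin⟩ := exists_min_image (univ.filter fun i => z i ≠ 0) τ ⟨j, by simpa using hj⟩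
  simp only [mem_filter, mem_univ, true_and] at hm hmin
  have hτ : 0 ≤ τ m := by
    simp only [τ]
    split_ifs with h
    · exact div_nonneg (by linarith [(hy m).2]) h.le
    · exact div_nonneg (hy m).1 (by linarith)
  have hb : ∀ i, y i + τ m * z i ∈ Set.Icc (0 : ℝ) 1 := by
    intro i
    rcases lt_trichotomy (z i) 0 with h | h | h
    · have h1 := hmin i h.ne
      simp only [τ, if_neg h.not_gt] at h1
      rw [le_div_iff₀ (by linarith)] at h1
      constructor
      · simp only [τ]; linarith
      · have := mul_nonneg hτ (neg_nonneg.mpr h.le)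
        linarith [(hy i).2]
    · simpa [h] using hy i
    · have h1 := hmin i h.ne'
      simp only [τ, if_pos h] at h1
      rw [le_div_iff₀ h] at h1
      constructor
      · have := mul_nonneg hτ h.le
        linarith [(hy i).1]
      · simp only [τ]; linarith
  refine ⟨τ m, hb, Finset.ssubset_iff_subset_ne.mpr ⟨fun i hi => ?_, fun heq => ?_⟩⟩
  · by_contra hn
    rw [mem_fractional] at hi
    simp only [hS i hn, mul_zero, add_zero] at hi
    exact hn (mem_fractional.mpr hi)
  · have hmem : m ∈ fractional y := by
      by_contra hn
      exact hm (hS m hn)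
    rw [← heq, mem_fractional] at hmem
    rcases lt_or_gt_of_ne hm with h | h
    · have : τ m * z m = -y m := by
        simp only [τ, if_neg h.not_gt]
        field_simp
      linarith [hmem.1]
    · have : τ m * z m = 1 - y m := by
        simp only [τ, if_pos h]
        field_simp
      linarith [hmem.2]

/-- Rounding along the kernel of finitely many linear functionals leaves at most as many
fractional coordinates as there are functionals. -/
theorem exists_rounding_card_fractional_le {ι κ : Type*} [Fintype ι] [Fintype κ]
    (A : κ → ι → ℝ) (y : ι → ℝ) (hy : ∀ i, y i ∈ Set.Icc (0 : ℝ) 1) :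
    ∃ y' : ι → ℝ, (∀ i, y' i ∈ Set.Icc (0 : ℝ) 1) ∧ (∀ i ∉ fractional y, y' i = y i) ∧
      (∀ k, ∑ i, y' i * A k i = ∑ i, y i * A k i) ∧
      (fractional y').card ≤ Fintype.card κ := by
  induction hn : (fractional y).card using Nat.strong_induction_on generalizing y with
  | _ n ih =>
    by_cases h : (fractional y).card ≤ Fintype.card κ
    · exact ⟨y, hy, fun _ _ => rfl, fun _ => rfl, h⟩
    obtain ⟨z, hz, hzS, hzA⟩ := exists_ne_zero_supported_of_card_lt (fractional y) A (not_le.mp h)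
    obtain ⟨t, ht, hsub⟩ := exists_step_to_boundary hy hz hzS
    obtain ⟨y', h1, h2, h3, h4⟩ := ih _ (hn ▸ card_lt_card hsub) _ ht rfl
    refine ⟨y', h1, fun i hi => ?_, fun k => ?_, h4⟩
    · rw [h2 i fun hi' => hi (hsub.1 hi'), hzS i hi, mul_zero, add_zero]
    · rw [h3 k]
      simp only [add_mul, sum_add_distrib, mul_assoc]
      rw [← mul_sum, hzA k, mul_zero, add_zero]

/-! ### Rounding against monotone functions -/

theorem exists_class_representatives {X : Type*} [Fintype X] (g : X → ℕ) (M : ℕ)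
    (hg : ∀ x, g x ≤ M) (rel : X → X → Prop)
    (h : ∀ x, ∃ r, g r = g x ∧ ∀ x', g x' = g x → rel r x') :
    ∃ R : Finset X, R.card ≤ M + 1 ∧ ∀ x, ∃ r ∈ R, g r = g x ∧ rel r x := by
  classical
  have h' : ∀ t : (univ.image g : Finset ℕ), ∃ r, g r = t ∧ ∀ x', g x' = t → rel r x' := by
    rintro ⟨t, ht⟩
    obtain ⟨x, -, rfl⟩ := mem_image.mp ht
    exact h x
  choose φ hφ hrel using h'
  refine ⟨univ.image φ, ?_, fun x => ?_⟩
  · refine card_image_le.trans ?_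
    rw [card_univ, Fintype.card_coe, ← card_range (M + 1)]
    exact card_le_card fun t ht => by
      obtain ⟨x, -, rfl⟩ := mem_image.mp ht
      exact mem_range.mpr (Nat.lt_succ_of_le (hg x))
  · let t : (univ.image g : Finset ℕ) := ⟨g x, mem_image_of_mem g (mem_univ x)⟩
    exact ⟨φ t, mem_image_of_mem φ (mem_univ t), hφ t, hrel t x rfl⟩

/-- All differences `u i - v i` have the same sign, so their absolute values add up without
cancellation. For monotone functions compared at two points, this bounds the effect of any weight
change on `S` by the variation of the unweighted sum. -/
theorem abs_sum_sub_mul_le_of_abs_le_one {ι : Type*} [Fintype ι] (S : Finset ι) {d u v : ι → ℝ}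
    (hd : ∀ i, |d i| ≤ 1) (hS : ∀ i ∉ S, d i = 0) (huv : (∀ i, u i ≤ v i) ∨ ∀ i, v i ≤ u i) :
    |∑ i, d i * u i - ∑ i, d i * v i| ≤ |∑ i ∈ S, u i - ∑ i ∈ S, v i| := by
  have h1 : ∑ i, d i * u i - ∑ i, d i * v i = ∑ i ∈ S, d i * (u i - v i) := by
    rw [← sum_sub_distrib, ← sum_subset (subset_univ S)]
    · exact sum_congr rfl fun i _ => by ring
    · intro i _ hi; simp [hS i hi]
  have h2 : ∑ i ∈ S, |u i - v i| = |∑ i ∈ S, (u i - v i)| := by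
    rcases huv with h | h
    · rw [abs_of_nonpos (sum_nonpos fun i _ => sub_nonpos.mpr (h i)), ← sum_neg_distrib]
      exact sum_congr rfl fun i _ => abs_of_nonpos (sub_nonpos.mpr (h i))
    · rw [abs_of_nonneg (sum_nonneg fun i _ => sub_nonneg.mpr (h i))]
      exact sum_congr rfl fun i _ => abs_of_nonneg (sub_nonneg.mpr (h i))
  rw [h1, ← sum_sub_distrib, ← h2]
  refine (abs_sum_le_sum_abs _ _).trans (sum_le_sum fun i _ => ?_)
  rw [abs_mul]
  exact mul_le_of_le_one_left (abs_nonneg _) (hd i)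

/-- A fractional vector with `m` fractional coordinates can be rounded to a `0`-`1` vector with
error `O(log m)` against monotone `[0,1]`-valued functions. -/
theorem exists_integral_rounding {ι X : Type*} [Fintype ι] [Fintype X] [LinearOrder X]
    (F : ι → X → ℝ) (hF : ∀ i x, F i x ∈ Set.Icc (0 : ℝ) 1) (hmono : ∀ i, Monotone (F i))
    (y : ι → ℝ) (hy : ∀ i, y i ∈ Set.Icc (0 : ℝ) 1) :
    ∃ y' : ι → ℝ, (∀ i, y' i = 0 ∨ y' i = 1) ∧
      ∀ x, |∑ i, y' i * F i x - ∑ i, y i * F i x| ≤ 4 + 4 * Nat.log 2 (fractional y).card := by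
  classical
  induction hn : (fractional y).card using Nat.strong_induction_on generalizing y with
  | _ m ih =>
    by_cases hm : m < 4
    -- At most three fractional weights remain; all are rounded down, at cost below 4.
    · refine ⟨fun i => if y i = 1 then 1 else 0, fun i => by by_cases h : y i = 1 <;> simp [h],
        fun x => ?_⟩
      have h1 := abs_sum_sub_mul_le_of_abs_le_one (fractional y)
        (d := fun i => (if y i = 1 then 1 else 0) - y i) (u := fun i => F i x) (v := 0)
        (fun i => ?_) (fun i hi => ?_) (Or.inr fun i => (hF i x).1)
      · simp only [sub_mul, sum_sub_distrib, Pi.zero_apply, mul_zero, sum_const_zero,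
          sub_zero] at h1
        refine h1.trans ?_
        rw [abs_of_nonneg (sum_nonneg fun i _ => (hF i x).1)]
        have h2 : ∑ i ∈ fractional y, F i x ≤ ∑ i ∈ fractional y, (1 : ℝ) :=
          sum_le_sum fun i _ => (hF i x).2
        rw [sum_const, hn, nsmul_eq_mul, mul_one] at h2
        have h3 : (m : ℝ) < 4 := by exact_mod_cast hm
        have h4 : (0 : ℝ) ≤ Nat.log 2 m := Nat.cast_nonneg _
        linarith
      · have := hy i
        rw [abs_le]
        split_ifs <;> constructor <;> linarith [this.1, this.2]
      · rw [mem_fractional, not_and_or, not_lt, not_lt] at hi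
        rcases hi with h | h
        · have h0 : y i = 0 := le_antisymm h (hy i).1
          simp [h0]
        · have h0 : y i = 1 := le_antisymm (hy i).2 h
          simp [h0]
    · push Not at hm
      let G : X → ℝ := fun x => ∑ i ∈ fractional y, F i x
      have hG0 : ∀ x, 0 ≤ G x := fun x => sum_nonneg fun i _ => (hF i x).1
      have hGm : ∀ x, G x ≤ m := fun x => by
        have h2 : ∑ i ∈ fractional y, F i x ≤ ∑ i ∈ fractional y, (1 : ℝ) :=
          sum_le_sum fun i _ => (hF i x).2
        rwa [sum_const, hn, nsmul_eq_mul, mul_one] at h2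
      -- Classes on which `G` varies by less than 4: there are at most m/4 + 1 of them, which is at
      -- most m/2 because m ≥ 4.
      obtain ⟨R, hR, hrep⟩ := exists_class_representatives (fun x => ⌊G x / 4⌋₊) (m / 4)
        (fun x => by
          rw [← Nat.floor_div_eq_div (K := ℝ)]
          exact Nat.floor_mono (by push_cast; linarith [hGm x])) (fun _ _ => True)
        (fun x => ⟨x, rfl, fun _ _ => trivial⟩)
      obtain ⟨y₁, h1, h2, h3, h4⟩ := exists_rounding_card_fractional_le
        (fun (r : R) i => F i r) y hy
      rw [Fintype.card_coe] at h4
      have h5 : (fractional y₁).card ≤ m / 2 := by omega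
      obtain ⟨y', h6, h7⟩ := ih _ (by omega) y₁ h1 rfl
      refine ⟨y', h6, fun x => ?_⟩
      obtain ⟨r, hr, hgr, -⟩ := hrep x
      have h8 := abs_sum_sub_mul_le_of_abs_le_one (fractional y) (d := fun i => y₁ i - y i)
        (u := fun i => F i x) (v := fun i => F i r)
        (fun i => by
          rw [abs_le]; constructor <;> linarith [(h1 i).1, (h1 i).2, (hy i).1, (hy i).2])
        (fun i hi => sub_eq_zero.mpr (h2 i hi))
        ((le_total x r).imp (fun h i => hmono i h) fun h i => hmono i h)
      have h9 : |G x - G r| ≤ 4 := by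
        have e1 := Nat.floor_le (div_nonneg (hG0 x) (by norm_num : (0 : ℝ) ≤ 4))
        have e2 := Nat.lt_floor_add_one (G x / 4)
        have e3 := Nat.floor_le (div_nonneg (hG0 r) (by norm_num : (0 : ℝ) ≤ 4))
        have e4 := Nat.lt_floor_add_one (G r / 4)
        rw [hgr] at e3 e4
        rw [abs_le]
        constructor <;> linarith
      have h10 := h3 ⟨r, hr⟩
      simp only [sub_mul, sum_sub_distrib] at h8
      rw [h10, sub_self, sub_zero] at h8
      have h11 : (Nat.log 2 (fractional y₁).card : ℝ) + 1 ≤ Nat.log 2 m := by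
        have : Nat.log 2 (fractional y₁).card ≤ Nat.log 2 (m / 2) := Nat.log_mono_right h5
        have h12 : Nat.log 2 m = Nat.log 2 (m / 2) + 1 :=
          Nat.log_of_one_lt_of_le (by norm_num) (by omega)
        exact_mod_cast (by omega : Nat.log 2 (fractional y₁).card + 1 ≤ Nat.log 2 m)
      calc _ ≤ |∑ i, y' i * F i x - ∑ i, y₁ i * F i x|
            + |∑ i, y₁ i * F i x - ∑ i, y i * F i x| := abs_sub_le _ _ _
        _ ≤ _ := by
          have := h7 x
          have := h8.trans h9
          linarith

/-- A fractional vector of total mass at most `s` can be rounded to a `0`-`1` vector with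
error `O(log s)` against monotone `[0,1]`-valued functions. -/
theorem exists_integral_rounding_of_sum_le {ι X : Type*} [Fintype ι] [Fintype X] [LinearOrder X]
    (F : ι → X → ℝ) (hF : ∀ i x, F i x ∈ Set.Icc (0 : ℝ) 1) (hmono : ∀ i, Monotone (F i))
    (y : ι → ℝ) (hy : ∀ i, y i ∈ Set.Icc (0 : ℝ) 1) (s : ℕ) (hs : ∑ i, y i ≤ s) :
    ∃ y' : ι → ℝ, (∀ i, y' i = 0 ∨ y' i = 1) ∧
      ∀ x, |∑ i, y' i * F i x - ∑ i, y i * F i x| ≤ 9 + 4 * Nat.log 2 (s + 1) := by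
  classical
  let G : X → ℝ := fun x => ∑ i, y i * F i x
  have hG0 : ∀ x, 0 ≤ G x := fun x => sum_nonneg fun i _ => mul_nonneg (hy i).1 (hF i x).1
  have hGs : ∀ x, G x ≤ s := fun x => le_trans
    (sum_le_sum fun i _ => mul_le_of_le_one_right (hy i).1 (hF i x).2) hs
  have hfl : ∀ x, ⌊G x⌋₊ ≤ s := fun x => Nat.floor_le_of_le (hGs x)
  -- Both the least and the greatest point of each class are fixed. In between, the old and the new
  -- sums are monotone and lie in the same unit interval, hence differ by at most 1. No bound on the
  -- number of fractional weights is needed here.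
  have hex : ∀ x : X, ∃ r ∈ univ.filter fun x' => ⌊G x'⌋₊ = ⌊G x⌋₊,
      ∀ x' ∈ univ.filter fun x' => ⌊G x'⌋₊ = ⌊G x⌋₊, r ≤ x' := fun x =>
    exists_min_image _ id ⟨x, by simp⟩
  have hex' : ∀ x : X, ∃ r ∈ univ.filter fun x' => ⌊G x'⌋₊ = ⌊G x⌋₊,
      ∀ x' ∈ univ.filter fun x' => ⌊G x'⌋₊ = ⌊G x⌋₊, x' ≤ r := fun x =>
    exists_max_image _ id ⟨x, by simp⟩
  simp only [mem_filter, mem_univ, true_and] at hex hex'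
  obtain ⟨R, hR, hrep⟩ := exists_class_representatives _ s hfl (· ≤ ·) hex
  obtain ⟨R', hR', hrep'⟩ := exists_class_representatives _ s hfl (· ≥ ·) hex'
  obtain ⟨y₁, h1, -, h3, h4⟩ := exists_rounding_card_fractional_le
    (fun (r : (R ∪ R' : Finset X)) i => F i r) y hy
  rw [Fintype.card_coe] at h4
  have h5 : (fractional y₁).card ≤ 2 * (s + 1) := by
    have := card_union_le R R'
    omega
  have h6 : ∀ x, |∑ i, y₁ i * F i x - ∑ i, y i * F i x| ≤ 1 := by
    intro x
    obtain ⟨r, hr, hgr, hrx⟩ := hrep x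
    obtain ⟨r', hr', hgr', hrx'⟩ := hrep' x
    have a1 := h3 ⟨r, mem_union_left _ hr⟩
    have a2 := h3 ⟨r', mem_union_right _ hr'⟩
    have m1 : ∀ w : ι → ℝ, (∀ i, w i ∈ Set.Icc (0 : ℝ) 1) → ∀ p q : X, p ≤ q →
        ∑ i, w i * F i p ≤ ∑ i, w i * F i q := fun w hw p q hpq =>
      sum_le_sum fun i _ => mul_le_mul_of_nonneg_left (hmono i hpq) (hw i).1
    have b1 := m1 y₁ h1 r x hrx
    have b2 := m1 y₁ h1 x r' hrx'
    have c1 := m1 y hy r x hrx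
    have c2 := m1 y hy x r' hrx'
    have e3 := Nat.floor_le (hG0 r)
    have e4 := Nat.lt_floor_add_one (G r')
    rw [hgr] at e3
    rw [hgr'] at e4
    simp only [G] at e3 e4 a1 a2
    rw [abs_le]
    constructor <;> linarith
  obtain ⟨y', h7, h8⟩ := exists_integral_rounding F hF hmono y₁ h1
  refine ⟨y', h7, fun x => ?_⟩
  have h9 : (Nat.log 2 (fractional y₁).card : ℝ) ≤ Nat.log 2 (s + 1) + 1 := by
    have : Nat.log 2 (fractional y₁).card ≤ Nat.log 2 (2 * (s + 1)) := Nat.log_mono_right h5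
    rw [mul_comm, Nat.log_mul_base (by norm_num) (by omega)] at this
    exact_mod_cast this
  calc _ ≤ |∑ i, y' i * F i x - ∑ i, y₁ i * F i x|
        + |∑ i, y₁ i * F i x - ∑ i, y i * F i x| := abs_sub_le _ _ _
    _ ≤ _ := by
      have := h8 x
      have := h6 x
      linarith

/-! ### Masses and linearity of expectation -/

open Classical in
/-- The probability that an uncertain point is located in `r`. -/
noncomputable def UncertainPoint.mass {k : ℕ} (p : UncertainPoint k) (r : Set ℝ) : ℝ :=
  ∑ j, if p.loc j ∈ r then p.prob j else 0

theorem UncertainPoint.mass_mono {k : ℕ} (p : UncertainPoint k) : Monotone p.mass := by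
  intro r r' h
  refine sum_le_sum fun j _ => ?_
  by_cases h1 : p.loc j ∈ r
  · simp [h1, h h1]
  · rw [if_neg h1]
    split_ifs
    exacts [p.prob_nonneg j, le_rfl]

theorem UncertainPoint.mass_mem_Icc {k : ℕ} (p : UncertainPoint k) (r : Set ℝ) :
    p.mass r ∈ Set.Icc (0 : ℝ) 1 := by
  constructor
  · exact sum_nonneg fun j _ => by split_ifs; exacts [p.prob_nonneg j, le_rfl]
  · rw [← p.prob_sum]
    exact sum_le_sum fun j _ => by split_ifs; exacts [le_rfl, p.prob_nonneg j]

theorem UncertainPoint.mass_congr {k : ℕ} (p : UncertainPoint k) {r r' : Set ℝ}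
    (h : ∀ j, p.loc j ∈ r ↔ p.loc j ∈ r') : p.mass r = p.mass r' := by
  refine sum_congr rfl fun j _ => ?_
  by_cases hj : p.loc j ∈ r
  · rw [if_pos hj, if_pos ((h j).mp hj)]
  · rw [if_neg hj, if_neg fun h' => hj ((h j).mpr h')]

theorem UncertainPoint.mass_eq_one {k : ℕ} (p : UncertainPoint k) {r : Set ℝ}
    (h : ∀ j, p.loc j ∈ r) : p.mass r = 1 := by
  simp [UncertainPoint.mass, h, p.prob_sum]

theorem UncertainPoint.mass_eq_zero {k : ℕ} (p : UncertainPoint k) {r : Set ℝ}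
    (h : ∀ j, p.loc j ∉ r) : p.mass r = 0 := by
  simp [UncertainPoint.mass, h]

theorem UncertainPoint.mass_diff {k : ℕ} (p : UncertainPoint k) {r r' : Set ℝ} (h : r' ⊆ r) :
    p.mass (r \ r') = p.mass r - p.mass r' := by
  rw [UncertainPoint.mass, UncertainPoint.mass, UncertainPoint.mass, ← sum_sub_distrib]
  refine sum_congr rfl fun j _ => ?_
  by_cases h1 : p.loc j ∈ r' <;> by_cases h2 : p.loc j ∈ r <;> simp [h1, h2]
  exact absurd (h h1) h2

/-- Linearity of expectation. -/
theorem rangeExpectation_eq {n k : ℕ} (P : Fin n → UncertainPoint k) (T : Finset (Fin n))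
    (r : Set ℝ) : rangeExpectation P T r = (∑ i ∈ T, (P i).mass r) / T.card := by
  classical
  have key : ∀ i : T, ∑ Q : T → Fin k, (∏ i' : T, (P i').prob (Q i')) *
      (if (P i).loc (Q i) ∈ r then (1 : ℝ) else 0) = (P i).mass r := by
    intro i
    -- The indicator is absorbed into the `i`-th factor, so the sum over transversals splits into a
    -- product whose other factors are total probabilities, equal to 1.
    have h1 : ∀ Q : T → Fin k, (∏ i' : T, (P i').prob (Q i')) *
        (if (P i).loc (Q i) ∈ r then (1 : ℝ) else 0) =
        ∏ i' : T, (P i').prob (Q i') *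
          (if i' = i then (if (P i').loc (Q i') ∈ r then (1 : ℝ) else 0) else 1) := by
      intro Q
      rw [prod_mul_distrib, prod_ite_eq' univ i]
      simp
    rw [sum_congr rfl fun Q _ => h1 Q, ← Fintype.piFinset_univ, ← prod_univ_sum (fun _ => univ)
      (fun (i' : T) j => (P i').prob j *
        (if i' = i then (if (P i').loc j ∈ r then (1 : ℝ) else 0) else 1)),
      prod_eq_single i]
    · simp [UncertainPoint.mass]
    · intro b _ hb
      simp [hb, (P b).prob_sum]
    · simp
  rw [rangeExpectation, ← sum_coe_sort T, sum_congr rfl fun i _ => (key i).symm, sum_comm,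
    sum_div]
  refine sum_congr rfl fun Q _ => ?_
  rw [← mul_sum, sum_boole, mul_div_assoc]

/-! ### From rounding to coresets -/

/-- Rounding the weights s/n gives a set whose sums approximate s times the averages up to D. The
point `top` turns this into a bound on | |T| - s |, so replacing s by |T| as normaliser costs
another D/s. -/
theorem exists_subset_average_approx {n : ℕ} {X : Type*} [Fintype X] [LinearOrder X]
    (F : Fin n → X → ℝ) (hF : ∀ i x, F i x ∈ Set.Icc (0 : ℝ) 1) (hmono : ∀ i, Monotone (F i))
    (top : X) (htop : ∀ i, F i top = 1) (hn : 0 < n) {ε : ℝ} (hε : 0 < ε) (hε1 : ε ≤ 1) (s : ℕ)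
    (hs : 2 * (9 + 4 * (Nat.log 2 (s + 1) : ℝ)) ≤ ε * s) :
    ∃ T : Finset (Fin n), T.Nonempty ∧ T.card ≤ 2 * s ∧
      ∀ x, |(∑ i, F i x) / n - (∑ i ∈ T, F i x) / T.card| ≤ ε := by
  classical
  by_cases hns : n ≤ 2 * s
  · refine ⟨univ, ⟨⟨0, hn⟩, mem_univ _⟩, by simpa using hns, fun x => ?_⟩
    simp [hε.le]
  push Not at hns
  have hn' : (0 : ℝ) < n := by exact_mod_cast hn
  have hns' : (2 * s : ℝ) < n := by exact_mod_cast hns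
  set D : ℝ := 9 + 4 * (Nat.log 2 (s + 1) : ℝ) with hD
  have hD0 : 0 < D := by positivity
  have hspos : (0 : ℝ) < s := by
    by_contra h
    have : ε * s ≤ 0 := mul_nonpos_of_nonneg_of_nonpos hε.le (not_lt.mp h)
    linarith
  obtain ⟨y, hy01, hy⟩ := exists_integral_rounding_of_sum_le F hF hmono (fun _ => (s : ℝ) / n)
    (fun _ => ⟨by positivity, by rw [div_le_one hn']; linarith⟩) s (by
      simp [mul_div_cancel₀ _ hn'.ne'])
  let T : Finset (Fin n) := univ.filter fun i => y i = 1
  have hT : ∀ x, ∑ i, y i * F i x = ∑ i ∈ T, F i x := by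
    intro x
    rw [sum_filter]
    refine sum_congr rfl fun i _ => ?_
    rcases hy01 i with h | h <;> simp [h]
  have hcard : |(T.card : ℝ) - s| ≤ D := by
    have := hy top
    rw [hT top] at this
    simpa [htop, mul_div_cancel₀ _ hn'.ne'] using this
  have hsD : D ≤ s / 2 := by nlinarith
  have hTpos : (0 : ℝ) < T.card := by linarith [(abs_le.mp hcard).1]
  refine ⟨T, card_pos.mp (by exact_mod_cast hTpos), ?_, fun x => ?_⟩
  · have : (T.card : ℝ) ≤ 2 * s := by linarith [(abs_le.mp hcard).2]
    exact_mod_cast this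
  · have h1 := hy x
    rw [hT x, ← mul_sum] at h1
    have hB0 : 0 ≤ ∑ i ∈ T, F i x := sum_nonneg fun i _ => (hF i x).1
    have hB : ∑ i ∈ T, F i x ≤ T.card := by
      have : ∑ i ∈ T, F i x ≤ ∑ i ∈ T, (1 : ℝ) := sum_le_sum fun i _ => (hF i x).2
      simpa using this
    set B := ∑ i ∈ T, F i x
    set M := ∑ i, F i x
    set t : ℝ := (T.card : ℝ)
    have h2 : |M / n - B / s| ≤ D / s := by
      have : M / n - B / s = -(B - s / n * M) / s := by field_simp; ring
      rw [this, abs_div, abs_neg, abs_of_pos hspos]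
      exact div_le_div_of_nonneg_right h1 hspos.le
    have h3 : |B / s - B / t| ≤ D / s := by
      have : B / s - B / t = (B / t) * ((t - s) / s) := by field_simp
      rw [this, abs_mul, abs_div, abs_div, abs_of_pos hspos, abs_of_pos hTpos, abs_of_nonneg hB0]
      calc _ ≤ 1 * (|t - s| / s) := by
            gcongr
            rwa [div_le_one hTpos]
        _ ≤ D / s := by
            rw [one_mul]
            gcongr
    calc _ ≤ |M / n - B / s| + |B / s - B / t| := abs_sub_le _ _ _
      _ ≤ 2 * D / s := by
        have : 2 * D / s = D / s + D / s := by ring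
        rw [this]
        exact add_le_add h2 h3
      _ ≤ ε := by rwa [div_le_iff₀ hspos]

/-- One-sided coresets: it suffices to test the intervals that end at a location. -/
theorem isRECoreset_oneSided_iff {n k : ℕ} (P : Fin n → UncertainPoint k) (T : Finset (Fin n))
    {ε : ℝ} (hε : 0 ≤ ε) :
    IsRECoreset P T oneSided ε ↔ T.Nonempty ∧ ∀ i j,
      |(∑ i', (P i').mass (Set.Iic ((P i).loc j))) / n -
        (∑ i' ∈ T, (P i').mass (Set.Iic ((P i).loc j))) / T.card| ≤ ε := by
  classical
  refine and_congr_right fun _ => ⟨fun h i j => ?_, ?_⟩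
  · simpa [rangeExpectation_eq] using h _ ⟨(P i).loc j, rfl⟩
  · rintro h _ ⟨x, rfl⟩
    rw [rangeExpectation_eq, rangeExpectation_eq, card_univ, Fintype.card_fin]
    rcases (univ.filter fun q : Fin n × Fin k => (P q.1).loc q.2 ≤ x).eq_empty_or_nonempty
      with he | hne
    · have h0 : ∀ i, (P i).mass (Set.Iic x) = 0 := fun i => (P i).mass_eq_zero fun j hj => by
        have : (i, j) ∈ univ.filter fun q : Fin n × Fin k => (P q.1).loc q.2 ≤ x := by
          simpa using hj
        simp [he] at this
      simpa [h0] using hε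
    · obtain ⟨⟨i, j⟩, hq, hmax⟩ := exists_max_image _ (fun q => (P q.1).loc q.2) hne
      simp only [mem_filter, mem_univ, true_and] at hq hmax
      have h1 : ∀ i', (P i').mass (Set.Iic x) = (P i').mass (Set.Iic ((P i).loc j)) := fun i' =>
        (P i').mass_congr fun j' => ⟨fun h => hmax (i', j') h, fun h => le_trans h hq⟩
      simpa [h1] using h i j

theorem isRECoreset_twoSided {n k : ℕ} (P : Fin n → UncertainPoint k) (T : Finset (Fin n))
    {ε : ℝ} (h : IsRECoreset P T oneSided (ε / 2)) : IsRECoreset P T twoSided ε := by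
  classical
  refine ⟨h.1, ?_⟩
  rintro _ ⟨y, x, hyx, rfl⟩
  -- The greatest location left of `y`, or `y - 1` if there is none: removing `Iic z` from `Iic x`
  -- then leaves exactly the locations in [y, x].
  obtain ⟨z, hzy, hz⟩ : ∃ z < y, ∀ i j, (P i).loc j < y → (P i).loc j ≤ z := by
    rcases (univ.filter fun q : Fin n × Fin k => (P q.1).loc q.2 < y).eq_empty_or_nonempty
      with he | hne
    · refine ⟨y - 1, by linarith, fun i j hj => ?_⟩
      have : (i, j) ∈ univ.filter fun q : Fin n × Fin k => (P q.1).loc q.2 < y := by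
        simpa using hj
      simp [he] at this
    · obtain ⟨⟨i, j⟩, hq, hmax⟩ := exists_max_image _ (fun q => (P q.1).loc q.2) hne
      simp only [mem_filter, mem_univ, true_and] at hq hmax
      exact ⟨_, hq, fun i' j' h => hmax (i', j') h⟩
  have hm : ∀ i, (P i).mass (Set.Icc y x) = (P i).mass (Set.Iic x) - (P i).mass (Set.Iic z) := by
    intro i
    rw [← (P i).mass_diff (Set.Iic_subset_Iic.mpr (hzy.le.trans hyx))]
    refine (P i).mass_congr fun j => ?_
    simp only [Set.mem_Icc, Set.mem_sdiff, Set.mem_Iic, not_le]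
    constructor
    · rintro ⟨h1, h2⟩; exact ⟨h2, hzy.trans_le h1⟩
    · rintro ⟨h1, h2⟩; exact ⟨not_lt.mp fun h3 => (hz i j h3).not_gt h2, h1⟩
  have h1 := h.2 _ ⟨x, rfl⟩
  have h2 := h.2 _ ⟨z, rfl⟩
  simp only [rangeExpectation_eq] at h1 h2 ⊢
  simp only [hm, sum_sub_distrib, sub_div]
  rw [abs_le] at h1 h2 ⊢
  constructor <;> linarith [h1.1, h1.2, h2.1, h2.2]

/-- Here u = 1/ε and s is about 200 u L. Since L ≤ 2u, s + 1 is at most quadratic in u, so its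
logarithm is O(L). -/
theorem two_mul_nine_add_log_le {u L : ℝ} (hu : 1 ≤ u) (hL : L = Real.log (2 * u)) (s : ℕ)
    (hs : (s : ℝ) ≤ 200 * (u * L) + 1) :
    2 * (9 + 4 * (Nat.log 2 (s + 1) : ℝ)) ≤ 200 * L := by
  have hl2 := Real.log_two_gt_d9
  have hL2 : Real.log 2 ≤ L := hL ▸ Real.log_le_log (by norm_num) (by linarith)
  have hLu : L ≤ 2 * u := by
    rw [hL]; linarith [Real.log_le_sub_one_of_pos (by linarith : 0 < 2 * u)]
  have h1 : (Nat.log 2 (s + 1) : ℝ) * Real.log 2 ≤ Real.log (s + 1 : ℕ) := by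
    rw [← Real.log_pow]
    refine Real.log_le_log (by positivity) ?_
    exact_mod_cast Nat.pow_log_le_self 2 (by omega)
  have h2 : ((s + 1 : ℕ) : ℝ) ≤ 2 ^ 7 * (2 * u) ^ 2 := by
    push_cast
    nlinarith [mul_le_mul_of_nonneg_left hLu (by linarith : 0 ≤ u)]
  have h3 : Real.log (s + 1 : ℕ) ≤ 7 * Real.log 2 + 2 * L := by
    refine (Real.log_le_log (by positivity) h2).trans ?_
    rw [Real.log_mul (by positivity) (by positivity), Real.log_pow, Real.log_pow, hL]
    norm_num
  have h4 : (Nat.log 2 (s + 1) : ℝ) * Real.log 2 ≤ 9 * L := by linarith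
  have h5 : (Nat.log 2 (s + 1) : ℝ) ≤ 18 * L := by
    have h6 : (0 : ℝ) ≤ Nat.log 2 (s + 1) := Nat.cast_nonneg _
    nlinarith
  linarith

theorem exists_isRECoreset_oneSided {n k : ℕ} (P : Fin n → UncertainPoint k) {ε : ℝ} (hn : 0 < n)
    (hε : 0 < ε) (hε1 : ε ≤ 1) :
    ∃ T : Finset (Fin n), IsRECoreset P T oneSided ε ∧
      (T.card : ℝ) ≤ 500 * (Real.sqrt k / ε * Real.log (2 * k / ε)) := by
  classical
  have hk : 1 ≤ k := by
    by_contra h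
    obtain rfl : k = 0 := by omega
    simpa using (P ⟨0, hn⟩).prob_sum
  have hk' : (1 : ℝ) ≤ k := by exact_mod_cast hk
  have hu : 1 ≤ 1 / ε := by rwa [le_div_iff₀ hε, one_mul]
  set u := 1 / ε with hu'
  set L := Real.log (2 * u) with hL
  have hl2 := Real.log_two_gt_d9
  have hL2 : Real.log 2 ≤ L := Real.log_le_log (by norm_num) (by linarith)
  have huL : 1 / 2 ≤ u * L := by nlinarith
  let s := ⌈200 * (u * L)⌉₊
  have hs1 : (s : ℝ) ≤ 200 * (u * L) + 1 := (Nat.ceil_lt_add_one (by linarith)).le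
  have hs2 : 200 * (u * L) ≤ s := Nat.le_ceil _
  have hs : 2 * (9 + 4 * (Nat.log 2 (s + 1) : ℝ)) ≤ ε * s := by
    refine (two_mul_nine_add_log_le hu hL s hs1).trans ?_
    calc 200 * L = ε * (200 * (u * L)) := by rw [hu']; field_simp
      _ ≤ ε * s := by gcongr
  let V : Finset ℝ := univ.image fun q : Fin n × Fin k => (P q.1).loc q.2
  have hV : V.Nonempty := ⟨_, mem_image_of_mem _ (mem_univ (⟨0, hn⟩, ⟨0, hk⟩))⟩
  have hmemV : ∀ i j, (P i).loc j ∈ V := fun i j =>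
    mem_image_of_mem (fun q : Fin n × Fin k => (P q.1).loc q.2) (mem_univ (i, j))
  obtain ⟨T, hT, hTs, hTx⟩ := exists_subset_average_approx
    (fun i (x : V) => (P i).mass (Set.Iic (x : ℝ))) (fun i x => (P i).mass_mem_Icc _)
    (fun i x x' h => (P i).mass_mono (Set.Iic_subset_Iic.mpr h))
    ⟨V.max' hV, V.max'_mem hV⟩ (fun i => (P i).mass_eq_one fun j => V.le_max' _ (hmemV i j))
    hn hε hε1 s hs
  refine ⟨T, (isRECoreset_oneSided_iff P T hε.le).mpr ⟨hT, fun i j => hTx ⟨_, hmemV i j⟩⟩, ?_⟩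
  have h1 : (T.card : ℝ) ≤ 2 * s := by exact_mod_cast hTs
  -- The only place where k enters the size bound, through k ≥ 1 alone.
  have h2 : u * L ≤ Real.sqrt k / ε * Real.log (2 * k / ε) := by
    have : L ≤ Real.log (2 * k / ε) := by
      rw [hL]
      refine Real.log_le_log (by linarith) ?_
      rw [hu', mul_one_div]
      gcongr
      linarith
    have h3 : u ≤ Real.sqrt k / ε := by
      rw [hu']
      gcongr
      exact Real.one_le_sqrt.mpr hk'
    exact mul_le_mul h3 this (by linarith) (by linarith)
  linarith

/-! ### A primitive recursive exhaustive search -/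

theorem primrec_list_sum : Primrec (List.sum : List ℕ → ℕ) :=
  (Primrec.list_foldr (h := fun _ (q : ℕ × ℕ) => q.1 + q.2) Primrec.id (Primrec.const 0)
    (Primrec.nat_add.comp (Primrec.fst.comp Primrec.snd) (Primrec.snd.comp Primrec.snd))).of_eq
    fun l => by rw [List.sum_eq_foldr]; rfl

/-- All sublists of a list. -/
def subs (l : List ℕ) : List (List ℕ) :=
  l.foldr (fun a acc => acc ++ acc.map (a :: ·)) [[]]

theorem primrec_subs : Primrec subs := by
  refine Primrec.list_foldr (h := fun _ (q : ℕ × List (List ℕ)) => q.2 ++ q.2.map (q.1 :: ·))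
    Primrec.id (Primrec.const _) ?_
  refine Primrec.list_append.comp (Primrec.snd.comp Primrec.snd)
    (Primrec.list_map (Primrec.snd.comp Primrec.snd) ?_)
  exact Primrec.list_cons.comp (Primrec.fst.comp (Primrec.snd.comp Primrec.fst)) Primrec.snd

theorem mem_subs {l t : List ℕ} : t ∈ subs l ↔ t.Sublist l := by
  induction l generalizing t with
  | nil => simp [subs]
  | cons a l ih =>
    change t ∈ subs l ++ (subs l).map (a :: ·) ↔ _
    simp only [List.mem_append, List.mem_map, ih, List.sublist_cons_iff]
    constructor
    · rintro (h | ⟨t', h, rfl⟩)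
      exacts [Or.inl h, Or.inr ⟨t', rfl, h⟩]
    · rintro (h | ⟨t', rfl, h⟩)
      exacts [Or.inl h, Or.inr ⟨t', h, rfl⟩]

/-- The sum of the numerators of the locations of rank at most `t` in a row. -/
def rowCount (row : List (ℕ × ℕ)) (t : ℕ) : ℕ :=
  (row.map fun q => if q.1 ≤ t then q.2 else 0).sum

theorem primrec_rowCount : Primrec₂ rowCount := by
  refine primrec_list_sum.comp (Primrec.list_map Primrec.fst ?_)
  exact Primrec.ite (Primrec.nat_le.comp (Primrec.fst.comp Primrec.snd)
    (Primrec.snd.comp Primrec.fst)) (Primrec.snd.comp Primrec.snd) (Primrec.const 0)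

/-- The sum of `rowCount` over the rows with indices in `l`. -/
def rowsCount (rows : List (List (ℕ × ℕ))) (l : List ℕ) (t : ℕ) : ℕ :=
  (l.map fun i => rowCount (rows.getD i []) t).sum

theorem primrec_rowsCount :
    Primrec fun q : List (List (ℕ × ℕ)) × List ℕ × ℕ => rowsCount q.1 q.2.1 q.2.2 := by
  refine primrec_list_sum.comp (Primrec.list_map (Primrec.fst.comp Primrec.snd) ?_)
  exact primrec_rowCount.comp
    ((Primrec.list_getD []).comp (Primrec.fst.comp Primrec.fst) Primrec.snd)
    (Primrec.snd.comp (Primrec.snd.comp Primrec.fst))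

/-- The coreset condition at the threshold `t`, with denominators cleared. -/
def Approximates (t : ℕ) (q : Input × List ℕ) : Prop :=
  q.1.1.2 * (q.2.length * rowsCount q.1.2.2 (List.range q.1.2.2.length) t) ≤
      q.1.1.2 * (q.1.2.2.length * rowsCount q.1.2.2 q.2 t) +
        q.1.1.1 * (q.1.2.1 * (q.1.2.2.length * q.2.length)) ∧
    q.1.1.2 * (q.1.2.2.length * rowsCount q.1.2.2 q.2 t) ≤
      q.1.1.2 * (q.2.length * rowsCount q.1.2.2 (List.range q.1.2.2.length) t) +
        q.1.1.1 * (q.1.2.1 * (q.1.2.2.length * q.2.length))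

theorem primrecRel_approximates : PrimrecRel Approximates := by
  have hx : Primrec fun p : ℕ × Input × List ℕ => p.2.1 := Primrec.fst.comp Primrec.snd
  have hl : Primrec fun p : ℕ × Input × List ℕ => p.2.2 := Primrec.snd.comp Primrec.snd
  have ha : Primrec fun p : ℕ × Input × List ℕ => p.2.1.1.1 :=
    Primrec.fst.comp (Primrec.fst.comp hx)
  have hb : Primrec fun p : ℕ × Input × List ℕ => p.2.1.1.2 :=
    Primrec.snd.comp (Primrec.fst.comp hx)
  have hD : Primrec fun p : ℕ × Input × List ℕ => p.2.1.2.1 :=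
    Primrec.fst.comp (Primrec.snd.comp hx)
  have hR : Primrec fun p : ℕ × Input × List ℕ => p.2.1.2.2 :=
    Primrec.snd.comp (Primrec.snd.comp hx)
  have hn := Primrec.list_length.comp hR
  have hm := Primrec.list_length.comp hl
  have h1 := Primrec.nat_mul.comp hb (Primrec.nat_mul.comp hm (primrec_rowsCount.comp
    (hR.pair ((Primrec.list_range.comp hn).pair Primrec.fst))))
  have h2 := Primrec.nat_mul.comp hb (Primrec.nat_mul.comp hn (primrec_rowsCount.comp
    (hR.pair (hl.pair Primrec.fst))))
  have h3 := Primrec.nat_mul.comp ha (Primrec.nat_mul.comp hD (Primrec.nat_mul.comp hn hm))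
  exact (Primrec.nat_le.comp h1 (Primrec.nat_add.comp h2 h3)).and
    (Primrec.nat_le.comp h2 (Primrec.nat_add.comp h1 h3))

/-- The list `l` of indices passes the coreset test for the input `x`. -/
def Passes (x : Input) (l : List ℕ) : Prop :=
  0 < l.length ∧ ∀ t ∈ x.2.2.flatten.map Prod.fst, Approximates t (x, l)

theorem primrecRel_passes : PrimrecRel Passes := by
  refine PrimrecPred.and (Primrec.nat_lt.comp (Primrec.const 0)
    (Primrec.list_length.comp Primrec.snd)) ?_
  exact primrecRel_approximates.forall_mem_list.comp
    (Primrec.list_map (Primrec.list_flatten.comp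
      (Primrec.snd.comp (Primrec.snd.comp Primrec.fst))) (Primrec.fst.comp Primrec.snd).to₂)
    Primrec.id

open Classical in
/-- A shortest list of indices that passes the coreset test. -/
noncomputable def search (x : Input) : List ℕ :=
  (subs (List.range x.2.2.length)).foldl
    (fun best l => if Passes x l ∧ l.length < best.length then l else best)
    (List.range x.2.2.length)

theorem primrec_search : Primrec search := by
  classical
  have hr : Primrec fun x : Input => List.range x.2.2.length :=
    Primrec.list_range.comp (Primrec.list_length.comp (Primrec.snd.comp Primrec.snd))
  refine Primrec.list_foldl (h := fun (x : Input) (q : List ℕ × List ℕ) =>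
    if Passes x q.2 ∧ q.2.length < q.1.length then q.2 else q.1) (primrec_subs.comp hr) hr ?_
  exact Primrec.ite ((primrecRel_passes.comp Primrec.fst (Primrec.snd.comp Primrec.snd)).and
    (Primrec.nat_lt.comp (Primrec.list_length.comp (Primrec.snd.comp Primrec.snd))
      (Primrec.list_length.comp (Primrec.fst.comp Primrec.snd))))
    (Primrec.snd.comp Primrec.snd) (Primrec.fst.comp Primrec.snd)

open Classical in
-- The accumulator always passes and never gets longer, so the result is no longer than any passing
-- list that was met.
theorem foldl_shortest {α : Type*} (p : List α → Prop) (S : List (List α)) (init : List α)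
    (hi : p init) (r : List α)
    (hr : r = S.foldl (fun best l => if p l ∧ l.length < best.length then l else best) init) :
    p r ∧ (r = init ∨ r ∈ S) ∧ r.length ≤ init.length ∧ ∀ l ∈ S, p l → r.length ≤ l.length := by
  induction S generalizing init with
  | nil => subst hr; simpa using hi
  | cons l S ih =>
    rw [List.foldl_cons] at hr
    by_cases h : p l ∧ l.length < init.length
    · rw [if_pos h] at hr
      obtain ⟨h1, h2, h3, h4⟩ := ih l h.1 hr
      refine ⟨h1, Or.inr ?_, h3.trans h.2.le, ?_⟩
      · exact List.mem_cons.mpr h2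
      · intro l' hl' hp
        rcases List.mem_cons.mp hl' with rfl | hl'
        exacts [h3, h4 l' hl' hp]
    · rw [if_neg h] at hr
      obtain ⟨h1, h2, h3, h4⟩ := ih init hi hr
      refine ⟨h1, h2.imp_right (List.mem_cons_of_mem l), h3, ?_⟩
      intro l' hl' hp
      rcases List.mem_cons.mp hl' with rfl | hl'
      · exact h3.trans (not_lt.mp fun hlt => h ⟨hp, hlt⟩)
      · exact h4 l' hl' hp

/-! ### Correctness of the search -/

theorem rank_le_rank_iff {n k : ℕ} (P : Fin n → UncertainPoint k) (i i' : Fin n) (j j' : Fin k) :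
    rank P i j ≤ rank P i' j' ↔ (P i).loc j ≤ (P i').loc j' := by
  classical
  constructor
  · intro h
    by_contra! hlt
    refine h.not_gt (card_lt_card ((ssubset_iff_of_subset ?_).mpr ⟨(i', j'), ?_, ?_⟩))
    · exact fun q hq => by
        simp only [mem_filter, mem_univ, true_and] at hq ⊢
        exact hq.trans hlt
    · simpa using hlt
    · simp
  · intro h
    exact card_le_card fun q hq => by
      simp only [mem_filter, mem_univ, true_and] at hq ⊢
      exact hq.trans_le h

theorem rowCount_rank {n k : ℕ} (P : Fin n → UncertainPoint k) (c : Fin n → Fin k → ℕ) (D : ℕ)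
    (hD : 0 < D) (hc : ∀ i j, (P i).prob j = (c i j : ℝ) / D) (i i₀ : Fin n) (j₀ : Fin k) :
    (rowCount (List.ofFn fun j => (rank P i j, c i j)) (rank P i₀ j₀) : ℝ) =
      D * (P i).mass (Set.Iic ((P i₀).loc j₀)) := by
  have hD' : (D : ℝ) ≠ 0 := by positivity
  rw [rowCount, List.map_ofFn, List.sum_ofFn, UncertainPoint.mass, mul_sum]
  push_cast
  refine sum_congr rfl fun j _ => ?_
  simp only [Function.comp_apply, rank_le_rank_iff, Set.mem_Iic]
  split_ifs
  · rw [hc]; field_simp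
  · simp

theorem rowsCount_rank {n k : ℕ} (P : Fin n → UncertainPoint k) (c : Fin n → Fin k → ℕ) (D : ℕ)
    (hD : 0 < D) (hc : ∀ i j, (P i).prob j = (c i j : ℝ) / D) (T : Finset (Fin n)) (l : List ℕ)
    (hl : l.Nodup) (hlT : l.toFinset = T.map Fin.valEmbedding) (i₀ : Fin n) (j₀ : Fin k) :
    (rowsCount (List.ofFn fun i => List.ofFn fun j => (rank P i j, c i j)) l (rank P i₀ j₀) : ℝ) =
      D * ∑ i ∈ T, (P i).mass (Set.Iic ((P i₀).loc j₀)) := by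
  rw [rowsCount, ← List.sum_toFinset _ hl, hlT, sum_map, mul_sum]
  push_cast
  refine sum_congr rfl fun i _ => ?_
  rw [← rowCount_rank P c D hD hc]
  simp [List.getD_eq_getElem?_getD]

/-- One-sided ranges need testing only at locations, and ranks compare as locations do. Multiplying
the inequality by b·D·n·|T| makes it integral; its two signs become two inequalities without
subtraction. -/
theorem passes_iff {n k : ℕ} (P : Fin n → UncertainPoint k) (c : Fin n → Fin k → ℕ)
    (D a b : ℕ) (hn : 0 < n) (hD : 0 < D) (hc : ∀ i j, (P i).prob j = (c i j : ℝ) / D)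
    (hb : 0 < b) (T : Finset (Fin n)) (l : List ℕ)
    (hl : l.Nodup) (hlT : l.toFinset = T.map Fin.valEmbedding) :
    Passes (input P c D a b) l ↔ IsRECoreset P T oneSided ((a : ℝ) / b) := by
  have hcard : l.length = T.card := by
    rw [← List.toFinset_card_of_nodup hl, hlT, card_map]
  rw [isRECoreset_oneSided_iff P T (by positivity), Passes, hcard, card_pos]
  refine and_congr_right fun hT => ?_
  have hmem : ∀ p : ℕ → Prop, (∀ t ∈ (input P c D a b).2.2.flatten.map Prod.fst, p t) ↔
      ∀ i j, p (rank P i j) := by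
    intro p
    simp only [input, List.mem_map, List.mem_flatten, List.mem_ofFn, Prod.exists]
    constructor
    · exact fun h i j => h _ ⟨_, _, ⟨_, ⟨i, rfl⟩, List.mem_ofFn.mpr ⟨j, rfl⟩⟩, rfl⟩
    · rintro h _ ⟨t, m, ⟨_, ⟨i, rfl⟩, hm⟩, rfl⟩
      obtain ⟨j, hj⟩ := List.mem_ofFn.mp hm
      obtain ⟨rfl, rfl⟩ := Prod.mk.inj hj
      exact h i j
  rw [hmem]
  refine forall_congr' fun i => forall_congr' fun j => ?_
  have h1 := rowsCount_rank P c D hD hc T l hl hlT i j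
  have h2 := rowsCount_rank P c D hD hc univ (List.range n) List.nodup_range
    (by ext m; simp) i j
  have hn' : (0 : ℝ) < n := by exact_mod_cast hn
  have hD' : (0 : ℝ) < D := by exact_mod_cast hD
  have hb' : (0 : ℝ) < b := by exact_mod_cast hb
  have ht' : (0 : ℝ) < T.card := by exact_mod_cast card_pos.mpr hT
  simp only [Approximates, input, List.length_ofFn, hcard]
  rw [← Nat.cast_le (α := ℝ), ← Nat.cast_le (α := ℝ)]
  push_cast
  rw [h1, h2]
  set M := ∑ i', (P i').mass (Set.Iic ((P i).loc j))
  set B := ∑ i' ∈ T, (P i').mass (Set.Iic ((P i).loc j))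
  set t : ℝ := (T.card : ℝ)
  have hscale : (0 : ℝ) < b * D * n * t := by positivity
  have key : ∀ z q : ℝ, |z| ≤ q ↔ |b * D * n * t * z| ≤ b * D * n * t * q := fun z q => by
    rw [abs_mul, abs_of_pos hscale, mul_le_mul_iff_right₀ hscale]
  have e1 : b * D * n * t * (M / n - B / t) = b * (t * (D * M)) - b * (n * (D * B)) := by
    field_simp
  have e2 : b * D * n * t * ((a : ℝ) / b) = a * (D * (n * t)) := by
    field_simp
  rw [key, e1, e2, abs_le]
  constructor
  · rintro ⟨u1, u2⟩; constructor <;> linarith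
  · rintro ⟨u1, u2⟩; constructor <;> linarith

theorem search_spec {n k : ℕ} (P : Fin n → UncertainPoint k) (c : Fin n → Fin k → ℕ)
    (D a b : ℕ) (hn : 0 < n) (hD : 0 < D) (hc : ∀ i j, (P i).prob j = (c i j : ℝ) / D)
    (ha : 0 < a) (hab : a ≤ b) :
    ∃ T : Finset (Fin n), (search (input P c D a b)).toFinset = T.map Fin.valEmbedding ∧
      IsRECoreset P T oneSided ((a : ℝ) / b) ∧
      (T.card : ℝ) ≤
        500 * (Real.sqrt k / ((a : ℝ) / b) * Real.log (2 * k / ((a : ℝ) / b))) := by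
  classical
  have hb : 0 < b := by omega
  have ha' : (0 : ℝ) < a := by exact_mod_cast ha
  have hb' : (0 : ℝ) < b := by exact_mod_cast hb
  have hpass := passes_iff P c D a b hn hD hc hb
  have hsub : ∀ l : List ℕ, l.Sublist (List.range n) → l.Nodup ∧
      l.toFinset = (univ.filter fun i : Fin n => (i : ℕ) ∈ l).map Fin.valEmbedding := by
    intro l hl
    refine ⟨hl.nodup List.nodup_range, ?_⟩
    ext m
    simp only [List.mem_toFinset, mem_map, mem_filter, mem_univ, true_and,
      Fin.valEmbedding_apply]
    constructor
    · intro h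
      exact ⟨⟨m, List.mem_range.mp (hl.subset h)⟩, h, rfl⟩
    · rintro ⟨i, h, rfl⟩
      exact h
  have hlen : (input P c D a b).2.2.length = n := by simp [input]
  -- The whole family has error 0, so the initial value of the search passes.
  have huniv : Passes (input P c D a b) (List.range n) := by
    obtain ⟨h1, h2⟩ := hsub _ (List.Sublist.refl _)
    rw [hpass _ _ h1 h2]
    have : (univ.filter fun i : Fin n => (i : ℕ) ∈ List.range n) = univ := by
      ext i; simp
    rw [this]
    refine ⟨⟨⟨0, hn⟩, mem_univ _⟩, fun r _ => ?_⟩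
    rw [sub_self, abs_zero]
    positivity
  obtain ⟨h1, h2, -, h4⟩ := foldl_shortest (Passes (input P c D a b)) (subs (List.range n))
    (List.range n) huniv (search (input P c D a b)) (by rw [search, hlen])
  have h5 : (search (input P c D a b)).Sublist (List.range n) := by
    rcases h2 with h2 | h2
    · rw [h2]
    · exact mem_subs.mp h2
  obtain ⟨h6, h7⟩ := hsub _ h5
  refine ⟨_, h7, (hpass _ _ h6 h7).mp h1, ?_⟩
  obtain ⟨T, hT, hTcard⟩ := exists_isRECoreset_oneSided P hn (div_pos ha' hb')
    ((div_le_one hb').mpr (by exact_mod_cast hab))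
  refine le_trans ?_ hTcard
  -- The coreset known to exist, listed in increasing order, is one of the candidates; the search
  -- result is no longer.
  have h8 : ((List.range n).filter (· ∈ T.map Fin.valEmbedding)).Sublist (List.range n) :=
    List.filter_sublist
  have h9 : ((List.range n).filter (· ∈ T.map Fin.valEmbedding)).toFinset =
      T.map Fin.valEmbedding := by
    ext m
    simp only [List.mem_toFinset, List.mem_filter, List.mem_range, decide_eq_true_eq,
      and_iff_right_iff_imp, mem_map]
    rintro ⟨i, -, rfl⟩
    exact i.2
  have h10 := h4 _ (mem_subs.mpr h8) ((hpass T _ (hsub _ h8).1 h9).mpr hT)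
  rw [← List.toFinset_card_of_nodup h6, h7, card_map,
    ← List.toFinset_card_of_nodup (hsub _ h8).1, h9, card_map] at h10
  exact_mod_cast h10

/-! ### Constants and the two families of ranges -/

/-- Halving ε doubles the prefactor and at most doubles the logarithm, since its argument is at
least 2; hence 2000 = 4·500. -/
theorem size_bound_half {k : ℕ} (hk : 0 < k) {ε : ℝ} (hε : 0 < ε) (hε1 : ε ≤ 1) :
    500 * (Real.sqrt k / (ε / 2) * Real.log (2 * k / (ε / 2))) ≤
      2000 * (Real.sqrt k / ε * Real.log (2 * k / ε)) := by
  have hk' : (1 : ℝ) ≤ k := by exact_mod_cast hk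
  have h1 : 2 ≤ 2 * k / ε := by
    rw [le_div_iff₀ hε]; linarith
  have h2 : Real.log (2 * k / (ε / 2)) ≤ 2 * Real.log (2 * k / ε) := by
    have h3 : 2 * k / (ε / 2) = 2 * (2 * k / ε) := by field_simp
    rw [h3, Real.log_mul (by norm_num) (by positivity)]
    linarith [Real.log_le_log (by norm_num) h1]
  have h4 : Real.sqrt k / (ε / 2) = 2 * (Real.sqrt k / ε) := by field_simp
  rw [h4]
  have h5 : 0 ≤ Real.sqrt k / ε := by positivity
  nlinarith [mul_le_mul_of_nonneg_left h2 h5]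

theorem size_bound_mono {k : ℕ} (hk : 0 < k) {ε : ℝ} (hε : 0 < ε) (hε1 : ε ≤ 1) :
    500 * (Real.sqrt k / ε * Real.log (2 * k / ε)) ≤
      2000 * (Real.sqrt k / ε * Real.log (2 * k / ε)) := by
  have hk' : (1 : ℝ) ≤ k := by exact_mod_cast hk
  have h1 : 1 ≤ 2 * k / ε := by
    rw [le_div_iff₀ hε]; linarith
  have := Real.log_nonneg h1
  gcongr
  norm_num

theorem pos_of_uncertainPoint {k : ℕ} (p : UncertainPoint k) : 0 < k := by
  rcases Nat.eq_zero_or_pos k with rfl | h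
  · simpa using p.prob_sum
  · exact h

/-- The input with the error halved. -/
def halveError (x : Input) : Input := ((x.1.1, 2 * x.1.2), x.2)

theorem primrec_halveError : Primrec halveError :=
  ((Primrec.fst.comp Primrec.fst).pair (Primrec.nat_mul.comp (Primrec.const 2)
    (Primrec.snd.comp Primrec.fst))).pair Primrec.snd

end UncertainData

theorem mainTheorem2 :
    ∃ C : ℝ, 0 < C ∧
      ∀ A ∈ ({UncertainData.oneSided, UncertainData.twoSided} : Set (Set (Set ℝ))),
        -- existence, for real data
        (∀ (n k : ℕ) (P : Fin n → UncertainData.UncertainPoint k) (ε : ℝ),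
          0 < n → 0 < ε → ε ≤ 1 →
          ∃ T : Finset (Fin n), UncertainData.IsRECoreset P T A ε ∧
            (T.card : ℝ) ≤ C * (Real.sqrt k / ε * Real.log (2 * k / ε))) ∧
        -- construction, by one algorithm that compares locations
        (∃ alg : UncertainData.Input → List ℕ, Computable alg ∧
          ∀ (n k : ℕ) (P : Fin n → UncertainData.UncertainPoint k)
            (c : Fin n → Fin k → ℕ) (D a b : ℕ),
            0 < n → 0 < D → (∀ i j, (P i).prob j = (c i j : ℝ) / D) → 0 < a → a ≤ b →
            ∃ T : Finset (Fin n),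
              (alg (UncertainData.input P c D a b)).toFinset = T.map Fin.valEmbedding ∧
              UncertainData.IsRECoreset P T A ((a : ℝ) / b) ∧
              (T.card : ℝ) ≤
                C * (Real.sqrt k / ((a : ℝ) / b) * Real.log (2 * k / ((a : ℝ) / b)))) := by
  open UncertainData in
  have hab : ∀ a b : ℕ, 0 < a → a ≤ b → 0 < (a : ℝ) / b ∧ (a : ℝ) / b ≤ 1 := by
    intro a b ha hab
    have ha' : (0 : ℝ) < a := by exact_mod_cast ha
    have hab' : (a : ℝ) ≤ b := by exact_mod_cast hab
    exact ⟨div_pos ha' (by linarith), (div_le_one (by linarith)).mpr hab'⟩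
  refine ⟨2000, by norm_num, ?_⟩
  rintro A (rfl | rfl)
  · refine ⟨fun n k P ε hn hε hε1 => ?_, search, primrec_search.to_comp, ?_⟩
    · obtain ⟨T, h1, h2⟩ := exists_isRECoreset_oneSided P hn hε hε1
      exact ⟨T, h1, h2.trans (size_bound_mono (pos_of_uncertainPoint (P ⟨0, hn⟩)) hε hε1)⟩
    · intro n k P c D a b hn hD hc ha hle
      obtain ⟨T, h1, h2, h3⟩ := search_spec P c D a b hn hD hc ha hle
      exact ⟨T, h1, h2, h3.trans (size_bound_mono (pos_of_uncertainPoint (P ⟨0, hn⟩))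
        (hab a b ha hle).1 (hab a b ha hle).2)⟩
  · refine ⟨fun n k P ε hn hε hε1 => ?_, fun x => search (halveError x),
      (primrec_search.comp primrec_halveError).to_comp, ?_⟩
    · obtain ⟨T, h1, h2⟩ := exists_isRECoreset_oneSided P hn (half_pos hε) (by linarith)
      exact ⟨T, isRECoreset_twoSided P T h1,
        h2.trans (size_bound_half (pos_of_uncertainPoint (P ⟨0, hn⟩)) hε hε1)⟩
    · intro n k P c D a b hn hD hc ha hle
      obtain ⟨T, h1, h2, h3⟩ := search_spec P c D a (2 * b) hn hD hc ha (by omega)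
      have he : (a : ℝ) / (2 * b : ℕ) = (a : ℝ) / b / 2 := by
        push_cast; rw [div_div, mul_comm]
      rw [he] at h2 h3
      exact ⟨T, h1, isRECoreset_twoSided P T h2,
        h3.trans (size_bound_half (pos_of_uncertainPoint (P ⟨0, hn⟩))
          (hab a b ha hle).1 (hab a b ha hle).2)⟩
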